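/- Let $\mathcal{M}_2$ be the algebra of complex $2\times 2$ matrices, $\mathcal{D}=\{\rho\in\mathcal{M}_2:\rho\ge 0,\ \operatorname{Tr}\rho=1\}$ the set of density matrices, and let $\mathcal{S}$ be the convex set of stochastic maps, i.e. of completely positive, trace-preserving linear maps $\Phi:\mathcal{M}_2\to\mathcal{M}_2$. A pure state is a rank one orthogonal projection in $\mathcal{M}_2$; the pure states form the Bloch sphere $\{\tfrac12(I+\mathbf{w}\cdot\sigma):\mathbf{w}\in\mathbb{R}^3,\ |\mathbf{w}|=1\}$, where $\sigma=(\sigma_x,\sigma_y,\sigma_z)$ are the Pauli matrices. A map $\Phi$ is unital if $\Phi(I)=I$. Theorem. Let $\Phi\in\mathcal{S}$. 1. If $\Phi$ is an extreme point of $\mathcal{S}$, then at least one point in the image $\Phi(\mathcal{D})$ is a pure state. 2. If $\Phi(\mathcal{D})$ contains two or more pure states, then $\Phi$ is in the closure of the set of extreme points of $\mathcal{S}$. 3. If the intersection of $\Phi(\mathcal{D})$ with the Bloch sphere consists of exactly two non-orthogonal pure states, then $\Phi$ is a non-unital extreme point of $\mathcal{S}$. 4. $\Phi(\mathcal{D})$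 contains the entire Bloch sphere if and only if $\Phi$ is a unital extreme point of $\mathcal{S}$. -/

import Mathlib

/-- The algebra of complex `2 × 2` matrices. -/
abbrev M₂ : Type := Matrix (Fin 2) (Fin 2) ℂ

/-- Linear maps on `M₂` (all of them are continuous, as `M₂` is finite-dimensional). This type
carries the usual vector space topology, in which closures are taken. -/
abbrev QubitMap : Type := M₂ →L[ℂ] M₂

open scoped MatrixOrder Matrix.Norms.L2Operator CStarAlgebra in
/-- `Φ` is completely positive, where `M₂` is the C⋆-algebra of complex `2 × 2` matrices with the
operator norm and the positive semidefinite order. -/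
def IsCompletelyPositive (Φ : M₂ → M₂) : Prop :=
  ∃ Ψ : M₂ →CP M₂, ∀ A : M₂, Ψ A = Φ A

/-- The set `𝒮` of stochastic maps: completely positive and trace-preserving linear maps. -/
def stochasticMaps : Set QubitMap :=
  {Φ | IsCompletelyPositive Φ ∧ ∀ A : M₂, (Φ A).trace = A.trace}

open scoped ComplexOrder in
/-- The set `𝒟` of density matrices. -/
def densityMatrices : Set M₂ :=
  {ρ | ρ.PosSemidef ∧ ρ.trace = 1}

/-- The pure states: rank one (orthogonal) projections. -/
def pureStates : Set M₂ :=
  {ρ | IsStarProjection ρ ∧ ρ.rank = 1}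

/-- The matrix `½ (I + w · σ)`, with `σ = (σ_x, σ_y, σ_z)` the Pauli matrices. -/
noncomputable def blochMatrix (w : EuclideanSpace ℝ (Fin 3)) : M₂ :=
  (1 / 2 : ℂ) • ((1 : M₂) + (w 0 : ℂ) • !![0, 1; 1, 0]
    + (w 1 : ℂ) • !![0, -Complex.I; Complex.I, 0] + (w 2 : ℂ) • !![1, 0; 0, -1])

/-- The Bloch sphere, as a set of matrices. -/
def blochSphere : Set M₂ :=
  blochMatrix '' Metric.sphere 0 1

open Matrix ComplexConjugate

/-! ### Kraus representations of stochastic maps. -/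

section Kraus

theorem NonUnitalCStarAlgebra.nonneg_iff_exists_star_mul_self {B : Type*}
    [NonUnitalCStarAlgebra B] [PartialOrder B] [StarOrderedRing B] (b : B) :
    0 ≤ b ↔ ∃ c, b = star c * c :=
  CStarAlgebra.nonneg_iff_eq_star_mul_self

/-- The map `X ↦ ∑ k, A k * X * (A k)ᴴ` with Kraus operators `A`. -/
noncomputable def krausMap {ι : Type*} [Fintype ι] (A : ι → M₂) : QubitMap :=
  ∑ k, LinearMap.toContinuousLinearMap (LinearMap.mulLeftRight ℂ (A k, (A k)ᴴ))

theorem krausMap_apply {ι : Type*} [Fintype ι] (A : ι → M₂) (X : M₂) :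
    krausMap A X = ∑ k, A k * X * (A k)ᴴ := by
  simp [krausMap]

open scoped MatrixOrder Matrix.Norms.L2Operator CStarAlgebra in
theorem isCompletelyPositive_krausMap {ι : Type*} [Fintype ι] (A : ι → M₂) :
    IsCompletelyPositive (krausMap A) := by
  refine ⟨⟨(krausMap A).toLinearMap, ?_⟩, fun X => rfl⟩
  intro n M hM
  obtain ⟨N, rfl⟩ := (NonUnitalCStarAlgebra.nonneg_iff_exists_star_mul_self _).mp hM
  -- Entrywise, `A k * (Xᴴ * Y) * (A k)ᴴ` is `(X * (A k)ᴴ)ᴴ * (Y * (A k)ᴴ)`, so each Kraus term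
  -- preserves the shape `star _ * _`.
  have h : (star N * N).map ((krausMap A).toLinearMap) =
      ∑ k, star (N.map (fun X => X * (A k)ᴴ)) * N.map (fun X => X * (A k)ᴴ) := by
    have hs : ∀ (s : Finset ι) (F : ι → CStarMatrix (Fin n) (Fin n) M₂) (i j : Fin n),
        (∑ k ∈ s, F k) i j = ∑ k ∈ s, F k i j := by
      classical
      intro s F i j
      induction s using Finset.induction_on with
      | empty => simp
      | insert a s ha ih => simp [Finset.sum_insert ha, ih]
    ext1 i j
    rw [hs]
    simp only [CStarMatrix.map_apply, CStarMatrix.mul_apply, CStarMatrix.star_apply]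
    simp [krausMap_apply, star_eq_conjTranspose,
      Matrix.mul_assoc]
    exact Finset.sum_comm
  rw [h]
  exact Finset.sum_nonneg fun k _ => star_mul_self_nonneg _

theorem krausMap_mem_stochasticMaps {ι : Type*} [Fintype ι] {A : ι → M₂}
    (hA : ∑ k, (A k)ᴴ * A k = 1) : krausMap A ∈ stochasticMaps := by
  refine ⟨isCompletelyPositive_krausMap A, fun X => ?_⟩
  rw [krausMap_apply, trace_sum]
  calc ∑ k, (A k * X * (A k)ᴴ).trace = ∑ k, ((A k)ᴴ * A k * X).trace := by
        refine Finset.sum_congr rfl fun k _ => ?_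
        rw [trace_mul_comm, Matrix.mul_assoc]
    _ = X.trace := by rw [← trace_sum, ← Finset.sum_mul, hA, one_mul]

open scoped MatrixOrder Matrix.Norms.L2Operator CStarAlgebra in
theorem IsCompletelyPositive.exists_krausMap {Φ : QubitMap} (h : IsCompletelyPositive Φ) :
    ∃ A : Fin 2 × Fin 2 → M₂, Φ = krausMap A := by
  obtain ⟨Ψ, hΨ⟩ := h
  -- Only row 0 of `N` is nonzero, so `star N * N` has the matrix unit `single i j 1` as its `(i,
  -- j)` block. Its image under `Ψ` is the Choi matrix, and a factorization of that matrix yields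
  -- the Kraus operators.
  let N : CStarMatrix (Fin 2) (Fin 2) M₂ :=
    CStarMatrix.ofMatrix (Matrix.of fun l j => if l = 0 then Matrix.single 0 j 1 else 0)
  have hpos := Ψ.map_cstarMatrix_nonneg (star N * N) (star_mul_self_nonneg N)
  obtain ⟨P, hP⟩ := (NonUnitalCStarAlgebra.nonneg_iff_exists_star_mul_self _).mp hpos
  have hE : ∀ i j : Fin 2, Φ (Matrix.single i j 1) = ∑ l, (P l i)ᴴ * P l j := by
    intro i j
    have := congrArg (fun M : CStarMatrix (Fin 2) (Fin 2) M₂ => M i j) hP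
    simp only [CStarMatrix.map_apply, CStarMatrix.mul_apply, CStarMatrix.star_apply] at this
    refine Eq.trans ?_ this
    rw [← hΨ]
    congr 1
    simp [N, star_eq_conjTranspose]
  refine ⟨fun p => Matrix.of fun a i => conj (P p.1 i p.2 a), ?_⟩
  ext1 X
  rw [krausMap_apply, Matrix.matrix_eq_sum_single X]
  simp only [map_sum]
  have hs : ∀ i j : Fin 2, Φ (Matrix.single i j (X i j)) = X i j • ∑ l, (P l i)ᴴ * P l j := by
    intro i j
    rw [← hE, ← map_smul]
    simp
  simp only [hs]
  ext a b
  simp [Fin.sum_univ_two, Fintype.sum_prod_type, Matrix.add_apply, Matrix.mul_apply,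
    Matrix.single_apply]
  ring

theorem exists_krausMap_of_mem_stochasticMaps {Φ : QubitMap} (h : Φ ∈ stochasticMaps) :
    ∃ A : Fin 2 × Fin 2 → M₂, Φ = krausMap A ∧ ∑ k, (A k)ᴴ * A k = 1 := by
  obtain ⟨A, rfl⟩ := h.1.exists_krausMap
  refine ⟨A, rfl, ?_⟩
  refine Matrix.ext_iff_trace_mul_right.mpr fun X => ?_
  rw [one_mul, ← h.2 X, krausMap_apply, trace_sum, Finset.sum_mul, trace_sum]
  refine Finset.sum_congr rfl fun k _ => ?_
  rw [trace_mul_comm (A k * X), Matrix.mul_assoc]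

end Kraus

/-! ### Pure states as determinant conditions, unit vectors and Bloch vectors. -/

section PureStates

theorem mem_pureStates_iff_det {ρ : M₂} :
    ρ ∈ pureStates ↔ ρᴴ = ρ ∧ ρ.trace = 1 ∧ ρ.det = 0 := by
  -- Cayley–Hamilton: at trace one, being idempotent is the same as having determinant zero.
  have hCH : ρ * ρ = ρ.trace • ρ - ρ.det • 1 := by
    ext i j
    fin_cases i <;> fin_cases j <;>
      simp [Matrix.mul_apply, Fin.sum_univ_two, trace_fin_two, det_fin_two] <;> ring
  constructor
  · rintro ⟨hp, hr⟩
    have hdet : ρ.det = 0 := by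
      by_contra h
      have := rank_of_isUnit ρ ((isUnit_iff_isUnit_det ρ).mpr (isUnit_iff_ne_zero.mpr h))
      simp [hr] at this
    have h0 : ρ ≠ 0 := by
      rintro rfl
      simp at hr
    refine ⟨hp.isSelfAdjoint, ?_, hdet⟩
    have h1 : ρ * ρ = ρ := hp.isIdempotentElem
    rw [h1, hdet, zero_smul, sub_zero] at hCH
    have h2 : (ρ.trace - 1) • ρ = 0 := by rw [sub_smul, ← hCH, one_smul, sub_self]
    rcases smul_eq_zero.mp h2 with h | h
    · exact sub_eq_zero.mp h
    · exact absurd h h0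
  · rintro ⟨hh, ht, hd⟩
    rw [ht, hd, one_smul, zero_smul, sub_zero] at hCH
    refine ⟨⟨hCH, hh⟩, ?_⟩
    have h0 : ρ.rank ≠ 0 := by
      intro h
      rw [rank, Submodule.finrank_eq_zero, LinearMap.range_eq_bot] at h
      have : ρ = 0 := by
        rw [← mulVecLin_zero] at h
        exact mulVec_injective (funext fun v => LinearMap.congr_fun h v)
      simp [this] at ht
    have h2 : ρ.rank ≠ 2 := by
      intro h
      have : LinearIndependent ℂ ρ.col := by
        rw [linearIndependent_iff_card_eq_finrank_span, Set.finrank, ← rank_eq_finrank_span_cols, h]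
        simp
      rw [linearIndependent_cols_iff_isUnit, isUnit_iff_isUnit_det, hd] at this
      simp at this
    have := rank_le_card_width ρ
    simp at this
    omega

theorem mem_pureStates_iff_exists_vecMulVec {ρ : M₂} :
    ρ ∈ pureStates ↔ ∃ φ : Fin 2 → ℂ, star φ ⬝ᵥ φ = 1 ∧ ρ = vecMulVec φ (star φ) := by
  rw [mem_pureStates_iff_det]
  constructor
  · rintro ⟨hh, ht, hd⟩
    have h00 := congrFun (congrFun hh 0) 0
    have h01 := congrFun (congrFun hh 1) 0
    have h11 := congrFun (congrFun hh 1) 1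
    simp only [conjTranspose_apply, RCLike.star_def] at h00 h01 h11
    rw [det_fin_two] at hd
    rw [trace_fin_two] at ht
    obtain ⟨a, ha⟩ := Complex.conj_eq_iff_real.mp h00
    have hb : a * (1 - a) = Complex.normSq (ρ 0 1) := by
      have : ((a * (1 - a) : ℝ) : ℂ) = (Complex.normSq (ρ 0 1) : ℝ) := by
        rw [Complex.normSq_eq_conj_mul_self, h01]
        push_cast
        rw [← ha]
        linear_combination hd - ρ 0 0 * ht
      exact_mod_cast this
    by_cases h0 : a = 0
    · have h1 : ρ 0 1 = 0 := by
        rw [h0, zero_mul] at hb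
        exact Complex.normSq_eq_zero.mp hb.symm
      refine ⟨![0, 1], by simp [dotProduct, Fin.sum_univ_two], ?_⟩
      rw [ha, h0] at ht
      ext i j
      fin_cases i <;> fin_cases j <;> simp [vecMulVec_apply, h1, ha, h0, ← h01]
      simpa using ht
    · have hpos : 0 < a := by
        have := Complex.normSq_nonneg (ρ 0 1)
        rw [← hb] at this
        by_contra hneg
        have : a < 0 := lt_of_le_of_ne (not_lt.mp hneg) h0
        nlinarith
      have hs : (Real.sqrt a : ℂ) * Real.sqrt a = a := by
        exact_mod_cast Real.mul_self_sqrt hpos.le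
      have hs0 : (Real.sqrt a : ℂ) ≠ 0 := by
        exact_mod_cast (Real.sqrt_pos.mpr hpos).ne'
      have h11' : ρ 1 0 * ρ 0 1 = a * ρ 1 1 := by rw [← ha]; linear_combination -hd
      have hρ : ρ = vecMulVec ![(Real.sqrt a : ℂ), ρ 1 0 / Real.sqrt a]
          (star ![(Real.sqrt a : ℂ), ρ 1 0 / Real.sqrt a]) := by
        ext i j
        fin_cases i <;> fin_cases j <;> simp [vecMulVec_apply, ha, hs, ← h01] <;>
          field_simp
        rw [h01, mul_comm, h11', pow_two, hs]
      refine ⟨_, ?_, hρ⟩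
      rw [dotProduct_comm, ← trace_vecMulVec, ← hρ, trace_fin_two, ht]
  · rintro ⟨φ, hφ, rfl⟩
    simp only [dotProduct, Fin.sum_univ_two, Pi.star_apply, RCLike.star_def] at hφ
    refine ⟨?_, ?_, ?_⟩
    · simp [conjTranspose_vecMulVec]
    · simp only [trace_fin_two, vecMulVec_apply, Pi.star_apply, RCLike.star_def]
      linear_combination hφ
    · simp only [det_fin_two, vecMulVec_apply]
      ring

theorem blochSphere_eq_pureStates : blochSphere = pureStates := by
  ext ρ
  rw [mem_pureStates_iff_det]
  constructor
  · rintro ⟨w, hw, rfl⟩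
    rw [mem_sphere_zero_iff_norm, EuclideanSpace.norm_eq, Real.sqrt_eq_one, Fin.sum_univ_three] at hw
    simp only [Real.norm_eq_abs, sq_abs] at hw
    have hw' : (w 0 : ℂ) ^ 2 + (w 1 : ℂ) ^ 2 + (w 2 : ℂ) ^ 2 = 1 := by exact_mod_cast hw
    refine ⟨?_, ?_, ?_⟩
    · ext i j
      fin_cases i <;> fin_cases j <;> simp [blochMatrix] <;> ring
    · simp [blochMatrix, trace_fin_two]
    · simp [blochMatrix, det_fin_two]
      linear_combination (-1 / 4 : ℂ) * hw' + (1 / 4) * (w 1 : ℂ) ^ 2 * Complex.I_sq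
  · rintro ⟨hh, ht, hd⟩
    have h00 := congrFun (congrFun hh 0) 0
    have h01 := congrFun (congrFun hh 1) 0
    have h11 := congrFun (congrFun hh 1) 1
    simp only [conjTranspose_apply, RCLike.star_def] at h00 h01 h11
    rw [det_fin_two] at hd
    rw [trace_fin_two] at ht
    obtain ⟨a, ha⟩ := Complex.conj_eq_iff_real.mp h00
    have hb : (ρ 1 0) = (ρ 1 0).re + (ρ 1 0).im * Complex.I := (Complex.re_add_im _).symm
    have hc : (ρ 0 1) = (ρ 1 0).re - (ρ 1 0).im * Complex.I := by
      have : ρ 0 1 = conj (ρ 1 0) := by rw [← h01, Complex.conj_conj]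
      rw [this]
      apply Complex.ext <;> simp
    generalize (ρ 1 0).re = x at hb hc
    generalize (ρ 1 0).im = y at hb hc
    refine ⟨!₂[2 * x, 2 * y, 2 * a - 1], ?_, ?_⟩
    · rw [mem_sphere_zero_iff_norm, EuclideanSpace.norm_eq, Real.sqrt_eq_one, Fin.sum_univ_three]
      simp only [Real.norm_eq_abs, sq_abs]
      have : ((2 * x : ℝ) : ℂ) ^ 2 + ((2 * y : ℝ) : ℂ) ^ 2 + ((2 * a - 1 : ℝ) : ℂ) ^ 2 = 1 := by
        push_cast
        rw [hb, hc, ha] at hd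
        rw [ha] at ht
        linear_combination 4 * (y : ℂ) ^ 2 * Complex.I_sq - 4 * hd + 4 * a * ht
      exact_mod_cast this
    · have hd' : ρ 1 1 = 1 - a := by rw [← ha, ← ht]; ring
      ext i j
      fin_cases i <;> fin_cases j <;> simp [blochMatrix, ha, hb, hc, hd'] <;> ring

/-- A vector orthogonal to `φ`, of the same norm. -/
def perp (φ : Fin 2 → ℂ) : Fin 2 → ℂ := ![-conj (φ 1), conj (φ 0)]

theorem star_perp_dotProduct (φ u : Fin 2 → ℂ) : star (perp φ) ⬝ᵥ u = φ 0 * u 1 - φ 1 * u 0 := by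
  simp [perp, dotProduct, Fin.sum_univ_two]
  ring

theorem eq_smul_of_star_perp_dotProduct_eq_zero {φ u : Fin 2 → ℂ} (hφ : star φ ⬝ᵥ φ = 1)
    (h : star (perp φ) ⬝ᵥ u = 0) : u = (star φ ⬝ᵥ u) • φ := by
  rw [star_perp_dotProduct] at h
  simp only [dotProduct, Fin.sum_univ_two, Pi.star_apply, RCLike.star_def] at hφ ⊢
  ext i
  fin_cases i <;> simp
  · linear_combination (-u 0) * hφ + conj (φ 1) * (-h)
  · linear_combination (-u 1) * hφ + conj (φ 0) * h

theorem star_perp_dotProduct_vecMulVec_mulVec (φ u : Fin 2 → ℂ) :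
    star (perp φ) ⬝ᵥ (vecMulVec u (star u) *ᵥ perp φ) =
      (Complex.normSq (star (perp φ) ⬝ᵥ u) : ℂ) := by
  rw [vecMulVec_mulVec, Complex.normSq_eq_conj_mul_self]
  simp [perp, dotProduct, Fin.sum_univ_two]
  ring

-- For a positive semidefinite matrix a vanishing expectation puts `perp φ` in the kernel; being
-- Hermitian of trace one then leaves only the projection onto `φ`.
open scoped ComplexOrder in
theorem eq_vecMulVec_of_perp {d : M₂} (hd : d.PosSemidef) (ht : d.trace = 1) {φ : Fin 2 → ℂ}
    (hφ : star φ ⬝ᵥ φ = 1) (h : star (perp φ) ⬝ᵥ (d *ᵥ perp φ) = 0) :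
    d = vecMulVec φ (star φ) := by
  rw [hd.dotProduct_mulVec_zero_iff] at h
  have h0 := congrFun h 0
  have h1 := congrFun h 1
  have hh := hd.1
  have h00 := congrFun (congrFun hh 0) 0
  have h01 := congrFun (congrFun hh 1) 0
  have h10 := congrFun (congrFun hh 0) 1
  have h11 := congrFun (congrFun hh 1) 1
  simp only [conjTranspose_apply, RCLike.star_def] at h00 h01 h11 h10
  rw [trace_fin_two] at ht
  simp only [mulVec, perp, dotProduct, Fin.sum_univ_two, Pi.star_apply, RCLike.star_def,
    cons_val_zero, cons_val_one, Pi.zero_apply] at h0 h1 hφ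
  have h0' := congrArg conj h0
  have h1' := congrArg conj h1
  simp only [map_add, map_mul, map_neg, Complex.conj_conj, h00, h01, h10, h11, map_zero] at h0' h1'
  ext i j
  fin_cases i <;> fin_cases j <;> simp [vecMulVec_apply]
  · linear_combination (-d 0 0) * hφ + φ 0 * conj (φ 0) * ht - conj (φ 1) * h0' - φ 0 * h1
  · linear_combination (-d 0 1) * hφ + φ 0 * conj (φ 1) * ht + φ 0 * h0 - conj (φ 1) * h1'
  · linear_combination (-d 1 0) * hφ + φ 1 * conj (φ 0) * ht + conj (φ 0) * h0' - φ 1 * h1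
  · linear_combination (-d 1 1) * hφ + φ 1 * conj (φ 1) * ht + φ 0 * h1 + conj (φ 1) * h0'

end PureStates

/-! ### Normal form of a stochastic map with prescribed pure outputs. -/

section Rigidity

open scoped ComplexOrder in
theorem posSemidef_map_of_mem_stochasticMaps {Φ : QubitMap} (hΦ : Φ ∈ stochasticMaps) {d : M₂}
    (hd : d.PosSemidef) : (Φ d).PosSemidef := by
  obtain ⟨A, rfl, -⟩ := exists_krausMap_of_mem_stochasticMaps hΦ
  rw [krausMap_apply]
  exact posSemidef_sum _ fun k _ => hd.mul_mul_conjTranspose_same _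

theorem map_mem_densityMatrices {Φ : QubitMap} (hΦ : Φ ∈ stochasticMaps) {d : M₂}
    (hd : d ∈ densityMatrices) : Φ d ∈ densityMatrices :=
  ⟨posSemidef_map_of_mem_stochasticMaps hΦ hd.1, (hΦ.2 d).trans hd.2⟩

open scoped ComplexOrder in
theorem vecMulVec_mem_densityMatrices {ψ : Fin 2 → ℂ} (hψ : star ψ ⬝ᵥ ψ = 1) :
    vecMulVec ψ (star ψ) ∈ densityMatrices :=
  ⟨posSemidef_vecMulVec_self_star ψ, by rw [trace_vecMulVec, dotProduct_comm, hψ]⟩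

theorem star_perp_dotProduct_vecMulVec_self (φ : Fin 2 → ℂ) :
    star (perp φ) ⬝ᵥ (vecMulVec φ (star φ) *ᵥ perp φ) = 0 := by
  rw [star_perp_dotProduct_vecMulVec_mulVec, star_perp_dotProduct]
  simp [mul_comm]

theorem star_dotProduct_self_eq_normSq (v : Fin 2 → ℂ) :
    star v ⬝ᵥ v = ((Complex.normSq (v 0) + Complex.normSq (v 1) : ℝ) : ℂ) := by
  simp [dotProduct, Fin.sum_univ_two, Complex.normSq_eq_conj_mul_self]

theorem exists_smul_unit {v : Fin 2 → ℂ} (hv : v ≠ 0) :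
    ∃ c : ℝ, c ≠ 0 ∧ star ((c : ℂ) • v) ⬝ᵥ ((c : ℂ) • v) = 1 := by
  set r : ℝ := Complex.normSq (v 0) + Complex.normSq (v 1) with hr
  have hpos : 0 < r := by
    have h0 := Complex.normSq_nonneg (v 0)
    have h1 := Complex.normSq_nonneg (v 1)
    by_contra hneg
    apply hv
    ext i
    have e0 : Complex.normSq (v 0) = 0 := by linarith
    have e1 : Complex.normSq (v 1) = 0 := by linarith
    fin_cases i
    · exact Complex.normSq_eq_zero.mp e0
    · exact Complex.normSq_eq_zero.mp e1
  refine ⟨(Real.sqrt r)⁻¹, inv_ne_zero (Real.sqrt_pos.mpr hpos).ne', ?_⟩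
  rw [star_smul, smul_dotProduct, dotProduct_smul, star_dotProduct_self_eq_normSq, ← hr]
  have : (Real.sqrt r)⁻¹ * ((Real.sqrt r)⁻¹ * r) = 1 := by
    rw [← mul_assoc, ← mul_inv, Real.mul_self_sqrt hpos.le, inv_mul_cancel₀ hpos.ne']
  simp only [RCLike.star_def, Complex.conj_ofReal, smul_eq_mul]
  exact_mod_cast this

-- Split `d` into rank one terms. Their images have nonnegative expectations at `perp φ` summing to
-- zero, so each vanishes, and any nonzero term, normalized, serves as `ψ`.
open scoped ComplexOrder MatrixOrder in
theorem exists_pure_preimage {Φ : QubitMap} (hΦ : Φ ∈ stochasticMaps) {d : M₂}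
    (hd : d ∈ densityMatrices) {φ : Fin 2 → ℂ} (hφ : star φ ⬝ᵥ φ = 1)
    (h : Φ d = vecMulVec φ (star φ)) :
    ∃ ψ : Fin 2 → ℂ, star ψ ⬝ᵥ ψ = 1 ∧ Φ (vecMulVec ψ (star ψ)) = vecMulVec φ (star φ) := by
  obtain ⟨N, hN⟩ := CStarAlgebra.nonneg_iff_eq_star_mul_self.mp hd.1.nonneg
  let v : Fin 2 → Fin 2 → ℂ := fun r i => conj (N r i)
  have hdv : d = ∑ r, vecMulVec (v r) (star (v r)) := by
    rw [hN]
    ext i j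
    simp [v, Matrix.mul_apply, vecMulVec_apply, Matrix.sum_apply, star_eq_conjTranspose]
  have hpos : ∀ r, 0 ≤ star (perp φ) ⬝ᵥ (Φ (vecMulVec (v r) (star (v r))) *ᵥ perp φ) := fun r =>
    (posSemidef_map_of_mem_stochasticMaps hΦ
      (posSemidef_vecMulVec_self_star (v r))).dotProduct_mulVec_nonneg _
  have hsum : ∑ r, star (perp φ) ⬝ᵥ (Φ (vecMulVec (v r) (star (v r))) *ᵥ perp φ) = 0 := by
    rw [← dotProduct_sum, ← sum_mulVec, ← map_sum, ← hdv, h,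
      star_perp_dotProduct_vecMulVec_self]
  have hzero := (Finset.sum_eq_zero_iff_of_nonneg fun r _ => hpos r).mp hsum
  obtain ⟨r, hr⟩ : ∃ r, v r ≠ 0 := by
    by_contra! hall
    have := hd.2
    simp [hdv, hall] at this
  obtain ⟨c, -, hc⟩ := exists_smul_unit hr
  refine ⟨(c : ℂ) • v r, hc, ?_⟩
  have hdens := map_mem_densityMatrices hΦ (vecMulVec_mem_densityMatrices hc)
  refine eq_vecMulVec_of_perp hdens.1 hdens.2 hφ ?_
  rw [star_smul, smul_vecMulVec, vecMulVec_smul, map_smul, map_smul, smul_mulVec, smul_mulVec,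
    dotProduct_smul, dotProduct_smul, hzero r (Finset.mem_univ r), smul_zero, smul_zero]

-- Pure states are extreme in the density matrices: the zero expectation at `perp φ` is a positive
-- combination of two nonnegative ones.
open scoped ComplexOrder in
theorem eq_vecMulVec_of_mem_openSegment {d d₁ d₂ : M₂} (h₁ : d₁ ∈ densityMatrices)
    (h₂ : d₂ ∈ densityMatrices) {φ : Fin 2 → ℂ} (hφ : star φ ⬝ᵥ φ = 1)
    (hd : d = vecMulVec φ (star φ)) (h : d ∈ openSegment ℝ d₁ d₂) : d₁ = d := by
  obtain ⟨a, b, ha, hb, -, hab⟩ := h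
  have hz := star_perp_dotProduct_vecMulVec_self φ
  rw [← hd, ← hab, add_mulVec, smul_mulVec, smul_mulVec, dotProduct_add, dotProduct_smul,
    dotProduct_smul] at hz
  have p₁ := h₁.1.dotProduct_mulVec_nonneg (perp φ)
  have p₂ := h₂.1.dotProduct_mulVec_nonneg (perp φ)
  have := ((add_eq_zero_iff_of_nonneg (smul_nonneg ha.le p₁) (smul_nonneg hb.le p₂)).mp hz).1
  rw [smul_eq_zero] at this
  rw [hd]
  exact eq_vecMulVec_of_perp h₁.1 h₁.2 hφ (this.resolve_left ha.ne')

theorem exists_smul_of_krausMap_eq {ι : Type*} [Fintype ι] {A : ι → M₂} {ψ φ : Fin 2 → ℂ}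
    (hφ : star φ ⬝ᵥ φ = 1)
    (h : krausMap A (vecMulVec ψ (star ψ)) = vecMulVec φ (star φ)) (k : ι) :
    ∃ c : ℂ, A k *ᵥ ψ = c • φ := by
  have hz := star_perp_dotProduct_vecMulVec_self φ
  rw [← h, krausMap_apply] at hz
  have hk : ∀ k, A k * vecMulVec ψ (star ψ) * (A k)ᴴ =
      vecMulVec (A k *ᵥ ψ) (star (A k *ᵥ ψ)) := fun k => by
    rw [mul_vecMulVec, vecMulVec_mul, star_mulVec]
  simp only [hk, sum_mulVec, dotProduct_sum, star_perp_dotProduct_vecMulVec_mulVec] at hz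
  have hz' : ∑ k, Complex.normSq (star (perp φ) ⬝ᵥ (A k *ᵥ ψ)) = 0 := by exact_mod_cast hz
  have := (Finset.sum_eq_zero_iff_of_nonneg fun k _ => Complex.normSq_nonneg _).mp hz' k
    (Finset.mem_univ k)
  exact ⟨_, eq_smul_of_star_perp_dotProduct_eq_zero hφ (Complex.normSq_eq_zero.mp this)⟩

/-- `Φ` sends the pure state of each column of `P` to that of the same column of `Q`. -/
def SendsColumns (Φ : QubitMap) (P Q : M₂) : Prop :=
  ∀ i, Φ (vecMulVec (P.col i) (star (P.col i))) = vecMulVec (Q.col i) (star (Q.col i))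

/-- The entrywise product of `X` with `!![1, m; conj m, 1]`. -/
def dephase (m : ℂ) (X : M₂) : M₂ := !![X 0 0, m * X 0 1; conj m * X 1 0, X 1 1]

theorem mul_single_mul_conjTranspose (P : M₂) (i : Fin 2) :
    P * single i i 1 * Pᴴ = vecMulVec (P.col i) (star (P.col i)) := by
  ext a b
  fin_cases i <;> simp [Matrix.mul_apply, Fin.sum_univ_two, vecMulVec_apply, single_apply]

theorem star_col_dotProduct_col (P : M₂) (i : Fin 2) :
    star (P.col i) ⬝ᵥ P.col i = (Pᴴ * P) i i := by
  simp [Matrix.mul_apply, dotProduct]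

/-- Rigidity gives `A k * P = Q * diagonal (c k)`. Trace preservation on column states makes each
family `fun k => c k i` a unit vector, and `m` is the inner product of the two families, so `‖m‖ ≤
1` is Cauchy–Schwarz. -/
theorem SendsColumns.exists_dephase {Φ : QubitMap} (hΦ : Φ ∈ stochasticMaps) {P Q : M₂}
    (h : SendsColumns Φ P Q) (hP : ∀ i, (Pᴴ * P) i i = 1) (hQ : ∀ i, (Qᴴ * Q) i i = 1) :
    ∃ m : ℂ, ‖m‖ ≤ 1 ∧ ∀ X, Φ (P * X * Pᴴ) = Q * dephase m X * Qᴴ := by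
  obtain ⟨A, rfl, hA⟩ := exists_krausMap_of_mem_stochasticMaps hΦ
  have hc : ∀ k i, ∃ c : ℂ, A k *ᵥ P.col i = c • Q.col i := fun k i =>
    exists_smul_of_krausMap_eq (by rw [star_col_dotProduct_col, hQ]) (h i) k
  choose c hc using hc
  have hAP : ∀ k, A k * P = Q * diagonal (c k) := by
    intro k
    ext a i
    have := congrFun (hc k i) a
    rw [mul_diagonal, mul_comm]
    exact this
  have hform : ∀ X, krausMap A (P * X * Pᴴ) =
      Q * (∑ k, diagonal (c k) * X * (diagonal (c k))ᴴ) * Qᴴ := by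
    intro X
    rw [krausMap_apply, Finset.mul_sum, Finset.sum_mul]
    refine Finset.sum_congr rfl fun k _ => ?_
    calc A k * (P * X * Pᴴ) * (A k)ᴴ = (A k * P) * X * (A k * P)ᴴ := by
          simp only [conjTranspose_mul, Matrix.mul_assoc]
      _ = _ := by
          rw [hAP]
          simp only [conjTranspose_mul, Matrix.mul_assoc]
  have hone : ∀ i, ∑ k, c k i * conj (c k i) = 1 := by
    intro i
    have hX : ∑ k, diagonal (c k) * single i i 1 * (diagonal (c k))ᴴ =
        (∑ k, c k i * conj (c k i)) • single i i (1 : ℂ) := by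
      rw [Finset.sum_smul]
      refine Finset.sum_congr rfl fun k _ => ?_
      ext a b
      simp only [diagonal_conjTranspose, mul_diagonal, diagonal_mul, Matrix.smul_apply, single_apply]
      split_ifs with hab
      · simp [← hab.1, ← hab.2]
      · simp
    have ht := hΦ.2 (P * single i i 1 * Pᴴ)
    rw [hform, hX, Matrix.mul_smul, Matrix.smul_mul, trace_smul, mul_single_mul_conjTranspose,
      mul_single_mul_conjTranspose, trace_vecMulVec, trace_vecMulVec, dotProduct_comm,
      star_col_dotProduct_col, dotProduct_comm, star_col_dotProduct_col, hP, hQ] at ht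
    simpa using ht
  refine ⟨∑ k, c k 0 * conj (c k 1), ?_, fun X => ?_⟩
  · have hone' : ∀ i, ∑ k, ‖c k i‖ ^ 2 = 1 := by
      intro i
      have := hone i
      simp only [Complex.mul_conj, Complex.normSq_eq_norm_sq] at this
      exact_mod_cast this
    calc ‖∑ k, c k 0 * conj (c k 1)‖ ≤ ∑ k, ‖c k 0 * conj (c k 1)‖ := norm_sum_le _ _
      _ ≤ ∑ k, (‖c k 0‖ ^ 2 + ‖c k 1‖ ^ 2) / 2 := by
          refine Finset.sum_le_sum fun k _ => ?_
          rw [norm_mul, RCLike.norm_conj]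
          nlinarith [sq_nonneg (‖c k 0‖ - ‖c k 1‖)]
      _ = 1 := by
          rw [← Finset.sum_div, Finset.sum_add_distrib, hone', hone']
          norm_num
  · rw [hform]
    congr 2
    ext a b
    simp only [Matrix.sum_apply, diagonal_conjTranspose, mul_diagonal, diagonal_mul, dephase,
      Pi.star_apply, RCLike.star_def]
    have hr : ∀ i j, ∑ k, c k i * X i j * conj (c k j) = (∑ k, c k i * conj (c k j)) * X i j := by
      intro i j
      rw [Finset.sum_mul]
      exact Finset.sum_congr rfl fun k _ => by ring
    rw [hr]
    fin_cases a <;> fin_cases b <;> simp [hone, mul_comm]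

/-- If `P *ᵥ x = 0`, then `dephase m` kills the rank one matrix of `x`; it leaves the diagonal
entries `‖x i‖ ^ 2` unchanged, so `x = 0`. -/
theorem isUnit_of_sendsColumns {Φ : QubitMap} {P Q : M₂} {m : ℂ} (hQ : IsUnit Q)
    (h : ∀ X, Φ (P * X * Pᴴ) = Q * dephase m X * Qᴴ) : IsUnit P := by
  rw [isUnit_iff_isUnit_det, isUnit_iff_ne_zero]
  intro hdet
  obtain ⟨x, hx, hPx⟩ := exists_mulVec_eq_zero_iff.mpr hdet
  have h1 := h (vecMulVec x (star x))
  rw [mul_vecMulVec, hPx, zero_vecMulVec, zero_mul, map_zero, eq_comm] at h1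
  have hQ' : IsUnit Qᴴ := by rwa [← star_eq_conjTranspose, isUnit_star]
  rw [hQ'.mul_left_eq_zero, hQ.mul_right_eq_zero] at h1
  apply hx
  ext i
  have h0 := congrFun (congrFun h1 i) i
  fin_cases i <;> simpa [dephase, vecMulVec_apply] using h0

/-- Trace preservation tested on the off-diagonal unit. When the columns of `Q` are not orthogonal,
this pins down `m`. -/
theorem conjTranspose_mul_self_eq_of_dephase {Φ : QubitMap} (hΦ : Φ ∈ stochasticMaps) {P Q : M₂}
    {m : ℂ} (h : ∀ X, Φ (P * X * Pᴴ) = Q * dephase m X * Qᴴ) :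
    (Pᴴ * P) 1 0 = m * (Qᴴ * Q) 1 0 := by
  have ht := hΦ.2 (P * single 0 1 1 * Pᴴ)
  have hs : dephase m (single 0 1 1) = m • single 0 1 1 := by
    ext i j
    fin_cases i <;> fin_cases j <;> simp [dephase]
  rw [h, hs, Matrix.mul_smul, Matrix.smul_mul, trace_smul, trace_mul_comm, ← Matrix.mul_assoc,
    trace_mul_comm (P * _), ← Matrix.mul_assoc, trace_mul_single, trace_mul_single] at ht
  simpa using ht.symm

theorem eq_of_forall_conjugate_eq {Φ Ψ : QubitMap} {P : M₂} (hP : IsUnit P)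
    (h : ∀ X, Φ (P * X * Pᴴ) = Ψ (P * X * Pᴴ)) : Φ = Ψ := by
  ext1 X
  obtain ⟨u, rfl⟩ := hP
  have hX : X = (u : M₂) * ((↑u⁻¹ : M₂) * X * (↑u⁻¹ : M₂)ᴴ) * (u : M₂)ᴴ := by
    have h2 : (↑u⁻¹ : M₂)ᴴ * (u : M₂)ᴴ = 1 := by
      rw [← conjTranspose_mul, u.mul_inv, conjTranspose_one]
    calc X = ((u : M₂) * ↑u⁻¹) * X * ((↑u⁻¹ : M₂)ᴴ * (u : M₂)ᴴ) := by
          rw [h2, u.mul_inv, one_mul, mul_one]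
      _ = _ := by simp only [Matrix.mul_assoc]
  rw [hX, h]

theorem SendsColumns.of_mem_openSegment {Φ Φ₁ Φ₂ : QubitMap} {P Q : M₂}
    (h : SendsColumns Φ P Q) (hP : ∀ i, (Pᴴ * P) i i = 1) (hQ : ∀ i, (Qᴴ * Q) i i = 1)
    (h₁ : Φ₁ ∈ stochasticMaps) (h₂ : Φ₂ ∈ stochasticMaps) (hs : Φ ∈ openSegment ℝ Φ₁ Φ₂) :
    SendsColumns Φ₁ P Q := by
  intro i
  have hd : vecMulVec (P.col i) (star (P.col i)) ∈ densityMatrices :=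
    vecMulVec_mem_densityMatrices (by rw [star_col_dotProduct_col, hP])
  rw [← h i]
  refine eq_vecMulVec_of_mem_openSegment (map_mem_densityMatrices h₁ hd)
    (map_mem_densityMatrices h₂ hd) (by rw [star_col_dotProduct_col, hQ]) (h i) ?_
  obtain ⟨a, b, ha, hb, hab, rfl⟩ := hs
  exact ⟨a, b, ha, hb, hab, rfl⟩

/-- A stochastic map sending two pure states to distinct non-orthogonal pure states is extreme. -/
theorem SendsColumns.mem_extremePoints {Φ : QubitMap} (hΦ : Φ ∈ stochasticMaps) {P Q : M₂}
    (h : SendsColumns Φ P Q) (hP : ∀ i, (Pᴴ * P) i i = 1) (hQ : ∀ i, (Qᴴ * Q) i i = 1)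
    (hu : IsUnit Q) (h0 : (Qᴴ * Q) 1 0 ≠ 0) : Φ ∈ stochasticMaps.extremePoints ℝ := by
  refine ⟨hΦ, fun Φ₁ h₁ Φ₂ h₂ hs => ?_⟩
  obtain ⟨m, -, hm⟩ := h.exists_dephase hΦ hP hQ
  obtain ⟨m₁, -, hm₁⟩ := (h.of_mem_openSegment hP hQ h₁ h₂ hs).exists_dephase h₁ hP hQ
  have e := conjTranspose_mul_self_eq_of_dephase hΦ hm
  rw [conjTranspose_mul_self_eq_of_dephase h₁ hm₁] at e
  have e' : m₁ = m := mul_right_cancel₀ h0 e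
  refine eq_of_forall_conjugate_eq (isUnit_of_sendsColumns hu hm) fun X => ?_
  rw [hm, hm₁, e']

end Rigidity

/-! ### Construction of the maps in normal form and their approximation by extreme maps. -/

section Dephasing

/-- The map `P * X * Pᴴ ↦ Q * dephase m X * Qᴴ`. -/
noncomputable def dephasingMap (P Q : M₂) (m : ℂ) : QubitMap :=
  krausMap ![Q * diagonal ![1, conj m] * P⁻¹, Q * diagonal ![0, (Real.sqrt (1 - ‖m‖ ^ 2) : ℂ)] * P⁻¹]

theorem conj_mul_self_add_sqrt {m : ℂ} (hm : ‖m‖ ≤ 1) :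
    conj m * m + (Real.sqrt (1 - ‖m‖ ^ 2) : ℂ) * (Real.sqrt (1 - ‖m‖ ^ 2) : ℂ) = 1 := by
  rw [Complex.conj_mul', ← Complex.ofReal_mul, Real.mul_self_sqrt]
  · push_cast
    ring
  · have := norm_nonneg m
    nlinarith

theorem dephasingMap_apply {P Q : M₂} {m : ℂ} (hP : IsUnit P) (hm : ‖m‖ ≤ 1) (X : M₂) :
    dephasingMap P Q m (P * X * Pᴴ) = Q * dephase m X * Qᴴ := by
  have hP' : P⁻¹ * P = 1 := nonsing_inv_mul P ((isUnit_iff_isUnit_det P).mp hP)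
  have hk : ∀ D : M₂, Q * D * P⁻¹ * (P * X * Pᴴ) * (Q * D * P⁻¹)ᴴ = Q * (D * X * Dᴴ) * Qᴴ := by
    intro D
    calc Q * D * P⁻¹ * (P * X * Pᴴ) * (Q * D * P⁻¹)ᴴ
        = Q * D * (P⁻¹ * P) * X * (P⁻¹ * P)ᴴ * Dᴴ * Qᴴ := by
          simp only [conjTranspose_mul, Matrix.mul_assoc]
      _ = _ := by simp only [hP', conjTranspose_one, mul_one, Matrix.mul_assoc]
  rw [dephasingMap, krausMap_apply, Fin.sum_univ_two]
  simp only [cons_val_zero, cons_val_one, hk]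
  rw [← Matrix.add_mul, ← Matrix.mul_add]
  congr 2
  have h := conj_mul_self_add_sqrt hm
  ext i j
  fin_cases i <;> fin_cases j <;> simp [dephase, diagonal_mul, mul_diagonal, mul_comm]
  linear_combination X 1 1 * h

/-- The adjoint of `dephase m` for the trace pairing is `dephase (conj m)` up to conjugate
transposition, so the Gram matrix hypothesis is exactly the Kraus normalization. -/
theorem dephasingMap_mem_stochasticMaps {P Q : M₂} {m : ℂ} (hP : IsUnit P) (hm : ‖m‖ ≤ 1)
    (h : Pᴴ * P = dephase (conj m) (Qᴴ * Q)) : dephasingMap P Q m ∈ stochasticMaps := by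
  have hP' : P * P⁻¹ = 1 := mul_nonsing_inv P ((isUnit_iff_isUnit_det P).mp hP)
  apply krausMap_mem_stochasticMaps
  have hk : ∀ D : M₂, (Q * D * P⁻¹)ᴴ * (Q * D * P⁻¹) = (P⁻¹)ᴴ * (Dᴴ * (Qᴴ * Q) * D) * P⁻¹ := by
    intro D
    simp only [conjTranspose_mul, Matrix.mul_assoc]
  rw [Fin.sum_univ_two]
  simp only [cons_val_zero, cons_val_one, hk]
  rw [← Matrix.add_mul, ← Matrix.mul_add]
  have hG : ∀ G : M₂, (diagonal ![1, conj m])ᴴ * G * diagonal ![1, conj m] +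
      (diagonal ![0, (Real.sqrt (1 - ‖m‖ ^ 2) : ℂ)])ᴴ * G *
        diagonal ![0, (Real.sqrt (1 - ‖m‖ ^ 2) : ℂ)] = dephase (conj m) G := by
    intro G
    have h := conj_mul_self_add_sqrt hm
    ext i j
    fin_cases i <;> fin_cases j <;> simp [dephase, diagonal_mul, mul_diagonal, mul_comm]
    linear_combination G 1 1 * h
  rw [hG, ← h]
  calc (P⁻¹)ᴴ * (Pᴴ * P) * P⁻¹ = (P * P⁻¹)ᴴ * (P * P⁻¹) := by
        simp only [conjTranspose_mul, Matrix.mul_assoc]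
    _ = 1 := by rw [hP', conjTranspose_one, one_mul]

theorem dephase_single (m : ℂ) (i : Fin 2) : dephase m (single i i 1) = single i i 1 := by
  ext a b
  fin_cases i <;> fin_cases a <;> fin_cases b <;> simp [dephase]

theorem sendsColumns_dephasingMap {P Q : M₂} {m : ℂ} (hP : IsUnit P) (hm : ‖m‖ ≤ 1) :
    SendsColumns (dephasingMap P Q m) P Q := by
  intro i
  rw [← mul_single_mul_conjTranspose, dephasingMap_apply hP hm, dephase_single,
    mul_single_mul_conjTranspose]

theorem dephase_one (m : ℂ) : dephase m 1 = 1 := by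
  ext a b
  fin_cases a <;> fin_cases b <;> simp [dephase]

/-- An upper triangular matrix whose columns are unit vectors with inner product `z`. -/
noncomputable def upperTri (z : ℂ) : M₂ := !![1, z; 0, (Real.sqrt (1 - ‖z‖ ^ 2) : ℂ)]

theorem conjTranspose_upperTri_mul_self {z : ℂ} (hz : ‖z‖ ≤ 1) :
    (upperTri z)ᴴ * upperTri z = !![1, z; conj z, 1] := by
  have h := conj_mul_self_add_sqrt hz
  ext i j
  fin_cases i <;> fin_cases j <;> simp [upperTri, Matrix.mul_apply, Fin.sum_univ_two]
  exact h

theorem isUnit_upperTri {z : ℂ} (hz : ‖z‖ < 1) : IsUnit (upperTri z) := by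
  rw [isUnit_iff_isUnit_det, isUnit_iff_ne_zero]
  have h : 0 < 1 - ‖z‖ ^ 2 := by
    have := norm_nonneg z
    nlinarith
  simpa [upperTri, det_fin_two] using (Real.sqrt_pos.mpr h).ne'

theorem upperTri_zero : upperTri 0 = 1 := by
  ext i j
  fin_cases i <;> fin_cases j <;> simp [upperTri]

theorem continuous_upperTri : Continuous upperTri := by
  unfold upperTri
  refine continuous_matrix fun i j => ?_
  fin_cases i <;> fin_cases j <;> simp <;> fun_prop

open Filter Topology

/-- In finite dimension a map depends linearly, hence continuously, on its values on a basis, so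
pointwise convergence suffices. -/
theorem QubitMap.tendsto_of_forall_apply {α : Type*} {l : Filter α} {F : α → QubitMap}
    {Φ : QubitMap} (h : ∀ X, Tendsto (fun a => F a X) l (𝓝 (Φ X))) : Tendsto F l (𝓝 Φ) := by
  let L : (M₂ →ₗ[ℂ] M₂) ≃ₗ[ℂ] QubitMap := LinearMap.toContinuousLinearMap
  let b := Matrix.stdBasis ℂ (Fin 2) (Fin 2)
  let K : (Fin 2 × Fin 2 → M₂) →ₗ[ℂ] QubitMap := L.toLinearMap ∘ₗ (b.constr ℂ).toLinearMap
  have hK : ∀ Ψ : QubitMap, K (fun p => Ψ (b p)) = Ψ := by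
    intro Ψ
    have : (b.constr ℂ) (fun p => Ψ (b p)) = Ψ.toLinearMap := b.ext fun p => by simp
    ext1 X
    exact LinearMap.congr_fun this X
  have hc : Continuous K := K.continuous_of_finiteDimensional
  have ht := (hc.tendsto (fun p => Φ (b p))).comp (tendsto_pi_nhds.mpr fun p => h (b p))
  rw [hK] at ht
  exact ht.congr fun a => hK (F a)

theorem tendsto_dephasingMap {α : Type*} {l : Filter α} {p q : α → M₂} {P Q : M₂} (hP : IsUnit P)
    (hp : Tendsto p l (𝓝 P)) (hq : Tendsto q l (𝓝 Q)) (m : ℂ) :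
    Tendsto (fun a => dephasingMap (p a) (q a) m) l (𝓝 (dephasingMap P Q m)) := by
  refine QubitMap.tendsto_of_forall_apply fun X => ?_
  simp only [dephasingMap, krausMap_apply]
  have hi : Tendsto (fun a => (p a)⁻¹) l (𝓝 P⁻¹) := by
    refine (continuousAt_matrix_inv P ?_).tendsto.comp hp
    rw [Ring.inverse_eq_inv']
    exact continuousAt_inv₀ (isUnit_iff_ne_zero.mp ((isUnit_iff_isUnit_det P).mp hP))
  have hA : ∀ D : M₂, Tendsto (fun a => q a * D * (p a)⁻¹) l (𝓝 (Q * D * P⁻¹)) := fun D =>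
    (hq.mul tendsto_const_nhds).mul hi
  have hs : Continuous fun Y : M₂ => Yᴴ := continuous_id.matrix_conjTranspose
  have hB : ∀ D : M₂, Tendsto (fun a => q a * D * (p a)⁻¹ * X * (q a * D * (p a)⁻¹)ᴴ) l
      (𝓝 (Q * D * P⁻¹ * X * (Q * D * P⁻¹)ᴴ)) := fun D =>
    ((hA D).mul tendsto_const_nhds).mul ((hs.tendsto _).comp (hA D))
  simp only [Fin.sum_univ_two, cons_val_zero, cons_val_one]
  exact (hB _).add (hB _)

theorem dephasingMap_mem_closure {P Q : M₂} {m : ℂ} (hP : Pᴴ * P = 1) (hQ : Qᴴ * Q = 1)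
    (hm : ‖m‖ ≤ 1) : dephasingMap P Q m ∈ closure (stochasticMaps.extremePoints ℝ) := by
  have hPu : IsUnit P := IsUnit.of_mul_eq_one_right _ hP
  have hQu : IsUnit Q := IsUnit.of_mul_eq_one_right _ hQ
  have hlim : ∀ (A : M₂) (w : ℂ), Tendsto (fun e : ℝ => A * upperTri (w * (e : ℂ))) (𝓝[>] 0) (𝓝 A) := by
    intro A w
    have hc : Continuous fun e : ℝ => A * upperTri (w * (e : ℂ)) :=
      continuous_const.mul (continuous_upperTri.comp (by fun_prop))
    have := hc.tendsto 0
    simp only [Complex.ofReal_zero, mul_zero, upperTri_zero, mul_one] at this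
    exact this.mono_left nhdsWithin_le_nhds
  -- The tilted columns have overlap `e` on the output side and `conj m * e` on the input side. This
  -- ratio keeps the same `m` compatible with trace preservation, and `e > 0` makes the outputs
  -- non-orthogonal.
  refine mem_closure_of_tendsto
    (tendsto_dephasingMap hPu (hlim P (conj m)) (hlim Q 1) m) ?_
  filter_upwards [Ioo_mem_nhdsGT (zero_lt_one' ℝ)] with e he
  have hG : ∀ {A : M₂} {z : ℂ}, Aᴴ * A = 1 → ‖z‖ ≤ 1 →
      (A * upperTri z)ᴴ * (A * upperTri z) = !![1, z; conj z, 1] := by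
    intro A z hA hz
    rw [← conjTranspose_upperTri_mul_self hz, conjTranspose_mul]
    calc (upperTri z)ᴴ * Aᴴ * (A * upperTri z) = (upperTri z)ᴴ * (Aᴴ * A) * upperTri z := by
          simp only [Matrix.mul_assoc]
      _ = _ := by rw [hA, mul_one]
  have h1 : ‖(1 : ℂ) * e‖ < 1 := by simpa [abs_of_pos he.1] using he.2
  have h2 : ‖conj m * e‖ < 1 := by
    rw [norm_mul, RCLike.norm_conj, Complex.norm_real, Real.norm_of_nonneg he.1.le]
    have := norm_nonneg m
    nlinarith [he.1, he.2]
  have hp := hG hP h2.le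
  have hq := hG hQ h1.le
  have hu : IsUnit (P * upperTri (conj m * e)) := hPu.mul (isUnit_upperTri h2)
  have hd : ∀ {z : ℂ} (i : Fin 2), (!![1, z; conj z, 1] : M₂) i i = 1 := by
    intro z i
    fin_cases i <;> simp
  refine (sendsColumns_dephasingMap hu hm).mem_extremePoints
    (dephasingMap_mem_stochasticMaps hu hm ?_) (fun i => ?_) (fun i => ?_)
    (hQu.mul (isUnit_upperTri h1)) ?_
  · rw [hp, hq]
    ext i j
    fin_cases i <;> fin_cases j <;> simp [dephase]
  · rw [hp, hd]
  · rw [hq, hd]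
  · rw [hq]
    simpa using he.1.ne'

end Dephasing

/-! ### Consequences of pure states in the image: closure, extremality, unitality. -/

section ImagePureStates

theorem isUnit_of_vecMulVec_col_ne {Q : M₂} (hQ : ∀ i, (Qᴴ * Q) i i = 1)
    (h : vecMulVec (Q.col 0) (star (Q.col 0)) ≠ vecMulVec (Q.col 1) (star (Q.col 1))) :
    IsUnit Q := by
  rw [isUnit_iff_isUnit_det, isUnit_iff_ne_zero]
  intro hdet
  apply h
  have hd := vecMulVec_mem_densityMatrices (ψ := Q.col 1) (by rw [star_col_dotProduct_col, hQ])
  refine (eq_vecMulVec_of_perp hd.1 hd.2 (by rw [star_col_dotProduct_col, hQ]) ?_).symm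
  rw [star_perp_dotProduct_vecMulVec_mulVec, star_perp_dotProduct]
  rw [det_fin_two] at hdet
  have : Q.col 0 0 * Q.col 1 1 - Q.col 0 1 * Q.col 1 0 = 0 := by
    simp only [col_apply]
    linear_combination hdet
  rw [this, map_zero, Complex.ofReal_zero]

theorem vecMulVec_col_mul_eq_zero_iff (Q : M₂) :
    vecMulVec (Q.col 0) (star (Q.col 0)) * vecMulVec (Q.col 1) (star (Q.col 1)) = 0 ↔
      (Qᴴ * Q) 1 0 = 0 := by
  have h10 : (Qᴴ * Q) 1 0 = star (Q.col 1) ⬝ᵥ Q.col 0 := by simp [Matrix.mul_apply, dotProduct]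
  have h01 : star (Q.col 0) ⬝ᵥ Q.col 1 = conj (star (Q.col 1) ⬝ᵥ Q.col 0) := by
    simp [dotProduct, mul_comm]
  rw [vecMulVec_mul_vecMulVec, h10, h01]
  constructor
  · intro h
    have ht := congrArg trace h
    rw [vecMulVec_smul, trace_smul, trace_vecMulVec, dotProduct_comm (Q.col 0), trace_zero,
      smul_eq_mul, mul_eq_zero, map_eq_zero, or_self] at ht
    exact ht
  · intro h
    simp [h]

theorem exists_col_eq (φ φ' : Fin 2 → ℂ) : ∃ Q : M₂, Q.col 0 = φ ∧ Q.col 1 = φ' :=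
  ⟨(of ![φ, φ'])ᵀ, rfl, rfl⟩

theorem exists_sendsColumns {Φ : QubitMap} (hΦ : Φ ∈ stochasticMaps) {ρ σ : M₂}
    (hρ : ρ ∈ pureStates) (hσ : σ ∈ pureStates) (hρΦ : ρ ∈ Φ '' densityMatrices)
    (hσΦ : σ ∈ Φ '' densityMatrices) (hne : ρ ≠ σ) :
    ∃ P Q : M₂, (∀ i, (Pᴴ * P) i i = 1) ∧ (∀ i, (Qᴴ * Q) i i = 1) ∧ IsUnit Q ∧
      SendsColumns Φ P Q ∧ (ρ * σ = 0 ↔ (Qᴴ * Q) 1 0 = 0) := by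
  obtain ⟨φ, hφ, rfl⟩ := mem_pureStates_iff_exists_vecMulVec.mp hρ
  obtain ⟨φ', hφ', rfl⟩ := mem_pureStates_iff_exists_vecMulVec.mp hσ
  obtain ⟨d, hd, e⟩ := hρΦ
  obtain ⟨d', hd', e'⟩ := hσΦ
  obtain ⟨ψ, hψ, hψφ⟩ := exists_pure_preimage hΦ hd hφ e
  obtain ⟨ψ', hψ', hψφ'⟩ := exists_pure_preimage hΦ hd' hφ' e'
  obtain ⟨P, rfl, rfl⟩ := exists_col_eq ψ ψ'
  obtain ⟨Q, rfl, rfl⟩ := exists_col_eq φ φ'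
  rw [star_col_dotProduct_col] at hψ hψ' hφ hφ'
  have hQ : ∀ i, (Qᴴ * Q) i i = 1 := Fin.forall_fin_two.mpr ⟨hφ, hφ'⟩
  exact ⟨P, Q, Fin.forall_fin_two.mpr ⟨hψ, hψ'⟩, hQ, isUnit_of_vecMulVec_col_ne hQ hne,
    Fin.forall_fin_two.mpr ⟨hψφ, hψφ'⟩, vecMulVec_col_mul_eq_zero_iff Q⟩

theorem mem_extremePoints_of_nonorthogonal {Φ : QubitMap} (hΦ : Φ ∈ stochasticMaps) {ρ σ : M₂}
    (hρ : ρ ∈ pureStates) (hσ : σ ∈ pureStates) (hρΦ : ρ ∈ Φ '' densityMatrices)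
    (hσΦ : σ ∈ Φ '' densityMatrices) (hne : ρ ≠ σ) (h0 : ρ * σ ≠ 0) :
    Φ ∈ stochasticMaps.extremePoints ℝ := by
  obtain ⟨P, Q, hP, hQ, hu, hs, hiff⟩ := exists_sendsColumns hΦ hρ hσ hρΦ hσΦ hne
  exact hs.mem_extremePoints hΦ hP hQ hu fun h => h0 (hiff.mpr h)

theorem conjTranspose_mul_self_eq_one {Q : M₂} (hQ : ∀ i, (Qᴴ * Q) i i = 1)
    (h : (Qᴴ * Q) 1 0 = 0) : Qᴴ * Q = 1 := by
  have h' : (Qᴴ * Q) 0 1 = 0 := by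
    rw [← (isHermitian_conjTranspose_mul_self Q).apply, h, star_zero]
  ext i j
  fin_cases i <;> fin_cases j <;> simp [hQ, h, h']

theorem exists_dephase_of_orthogonal {Φ : QubitMap} (hΦ : Φ ∈ stochasticMaps) {ρ σ : M₂}
    (hρ : ρ ∈ pureStates) (hσ : σ ∈ pureStates) (hρΦ : ρ ∈ Φ '' densityMatrices)
    (hσΦ : σ ∈ Φ '' densityMatrices) (hne : ρ ≠ σ) (h0 : ρ * σ = 0) :
    ∃ (P Q : M₂) (m : ℂ), Pᴴ * P = 1 ∧ Qᴴ * Q = 1 ∧ ‖m‖ ≤ 1 ∧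
      ∀ X, Φ (P * X * Pᴴ) = Q * dephase m X * Qᴴ := by
  obtain ⟨P, Q, hP, hQ, hu, hs, hiff⟩ := exists_sendsColumns hΦ hρ hσ hρΦ hσΦ hne
  obtain ⟨m, hm, hm'⟩ := hs.exists_dephase hΦ hP hQ
  have hq := hiff.mp h0
  have hp := conjTranspose_mul_self_eq_of_dephase hΦ hm'
  rw [hq, mul_zero] at hp
  exact ⟨P, Q, m, conjTranspose_mul_self_eq_one hP hp, conjTranspose_mul_self_eq_one hQ hq, hm, hm'⟩

theorem eq_dephasingMap {Φ : QubitMap} {P Q : M₂} {m : ℂ} (hP : IsUnit P) (hm : ‖m‖ ≤ 1)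
    (h : ∀ X, Φ (P * X * Pᴴ) = Q * dephase m X * Qᴴ) : Φ = dephasingMap P Q m :=
  eq_of_forall_conjugate_eq hP fun X => by rw [h, dephasingMap_apply hP hm]

theorem mem_closure_extremePoints_of_nontrivial {Φ : QubitMap} (hΦ : Φ ∈ stochasticMaps)
    (h : (Φ '' densityMatrices ∩ pureStates).Nontrivial) :
    Φ ∈ closure (stochasticMaps.extremePoints ℝ) := by
  obtain ⟨ρ, hρ, σ, hσ, hne⟩ := h
  by_cases h0 : ρ * σ = 0
  · obtain ⟨P, Q, m, hP, hQ, hm, hX⟩ :=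
      exists_dephase_of_orthogonal hΦ hρ.2 hσ.2 hρ.1 hσ.1 hne h0
    rw [eq_dephasingMap (IsUnit.of_mul_eq_one_right _ hP) hm hX]
    exact dephasingMap_mem_closure hP hQ hm
  · exact subset_closure (mem_extremePoints_of_nonorthogonal hΦ hρ.2 hσ.2 hρ.1 hσ.1 hne h0)

open scoped ComplexOrder in
theorem one_sub_mem_densityMatrices {d : M₂} (hd : d ∈ densityMatrices) :
    1 - d ∈ densityMatrices := by
  -- Spin flip: at trace one, `1 - d` is the adjugate of `d`, which is a conjugate of the transpose
  -- and hence positive.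
  have h : 1 - d = !![0, 1; -1, 0] * dᵀ * (!![0, 1; -1, 0] : M₂)ᴴ := by
    have ht := hd.2
    rw [trace_fin_two] at ht
    ext i j
    fin_cases i <;> fin_cases j <;>
      simp [Matrix.mul_apply, Fin.sum_univ_two, Matrix.vecMul, dotProduct]
    · linear_combination -ht
    · linear_combination -ht
  refine ⟨?_, ?_⟩
  · rw [h]
    exact hd.1.transpose.mul_mul_conjTranspose_same _
  · rw [trace_sub, hd.2, trace_one]
    norm_num

theorem one_sub_mem_pureStates {ρ : M₂} (hρ : ρ ∈ pureStates) : 1 - ρ ∈ pureStates := by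
  rw [mem_pureStates_iff_det] at hρ ⊢
  obtain ⟨hh, ht, hd⟩ := hρ
  refine ⟨by rw [conjTranspose_sub, conjTranspose_one, hh], ?_, ?_⟩
  · rw [trace_sub, ht, trace_one]
    norm_num
  · rw [det_fin_two] at hd ⊢
    rw [trace_fin_two] at ht
    simp
    linear_combination hd - ht

theorem mul_one_sub_of_mem_pureStates {ρ : M₂} (hρ : ρ ∈ pureStates) : ρ * (1 - ρ) = 0 := by
  rw [mul_sub, mul_one, hρ.1.isIdempotentElem.eq, sub_self]

theorem ne_zero_of_mem_pureStates {ρ : M₂} (hρ : ρ ∈ pureStates) : ρ ≠ 0 := by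
  rintro rfl
  simpa using hρ.2

theorem ne_one_sub_of_mem_pureStates {ρ : M₂} (hρ : ρ ∈ pureStates) : ρ ≠ 1 - ρ := by
  intro h
  have := mul_one_sub_of_mem_pureStates hρ
  rw [← h, hρ.1.isIdempotentElem.eq] at this
  exact ne_zero_of_mem_pureStates hρ this

theorem one_sub_mem_image {Φ : QubitMap} (h1 : Φ 1 = 1) {ρ : M₂}
    (hρ : ρ ∈ Φ '' densityMatrices) : 1 - ρ ∈ Φ '' densityMatrices := by
  obtain ⟨d, hd, rfl⟩ := hρ
  exact ⟨1 - d, one_sub_mem_densityMatrices hd, by rw [map_sub, h1]⟩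

theorem map_one_ne_one_of_inter_eq_pair {Φ : QubitMap} {ρ σ : M₂} (hρ : ρ ∈ pureStates)
    (h0 : ρ * σ ≠ 0) (h : Φ '' densityMatrices ∩ pureStates = {ρ, σ}) : Φ 1 ≠ 1 := by
  intro h1
  have hm : ρ ∈ Φ '' densityMatrices ∩ pureStates := by simp [h]
  have hm' : 1 - ρ ∈ Φ '' densityMatrices ∩ pureStates :=
    ⟨one_sub_mem_image h1 hm.1, one_sub_mem_pureStates hρ⟩
  rw [h] at hm'
  rcases hm' with h' | h'
  · exact ne_one_sub_of_mem_pureStates hρ h'.symm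
  · apply h0
    rw [← Set.mem_singleton_iff.mp h', mul_one_sub_of_mem_pureStates hρ]

/-- One non-orthogonal pair of outputs gives extremality; one orthogonal pair gives the unitary
normal form, which fixes the identity. -/
theorem unital_extreme_of_pureStates_subset {Φ : QubitMap} (hΦ : Φ ∈ stochasticMaps)
    (h : pureStates ⊆ Φ '' densityMatrices) :
    Φ ∈ stochasticMaps.extremePoints ℝ ∧ Φ 1 = 1 := by
  have hρ : (!![1, 0; 0, 0] : M₂) ∈ pureStates := by
    rw [mem_pureStates_iff_det]
    refine ⟨?_, by simp [trace_fin_two], by simp⟩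
    ext i j
    fin_cases i <;> fin_cases j <;> simp
  have hσ : (!![1 / 2, 1 / 2; 1 / 2, 1 / 2] : M₂) ∈ pureStates := by
    rw [mem_pureStates_iff_det]
    refine ⟨?_, by simp [trace_fin_two]; norm_num, by simp⟩
    ext i j
    fin_cases i <;> fin_cases j <;> simp
  constructor
  · refine mem_extremePoints_of_nonorthogonal hΦ hρ hσ (h hρ) (h hσ) (fun e => ?_) (fun e => ?_)
    · simpa using congrFun (congrFun e 0) 1
    · simpa using congrFun (congrFun e 0) 0
  · have hρ' := one_sub_mem_pureStates hρ
    obtain ⟨P, Q, m, hP, hQ, -, hX⟩ := exists_dephase_of_orthogonal hΦ hρ hρ' (h hρ) (h hρ')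
      (ne_one_sub_of_mem_pureStates hρ) (mul_one_sub_of_mem_pureStates hρ)
    have := hX 1
    rwa [dephase_one, mul_one, mul_one, mul_eq_one_comm.mp hP, mul_eq_one_comm.mp hQ] at this

theorem norm_eq_one_of_dephase_mem_extremePoints {Φ : QubitMap}
    (hΦ : Φ ∈ stochasticMaps.extremePoints ℝ) {P Q : M₂} {m : ℂ} (hP : Pᴴ * P = 1)
    (hQ : Qᴴ * Q = 1) (hm : ‖m‖ ≤ 1) (h : ∀ X, Φ (P * X * Pᴴ) = Q * dephase m X * Qᴴ) :
    ‖m‖ = 1 := by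
  by_contra hne
  have hPu : IsUnit P := IsUnit.of_mul_eq_one_right _ hP
  -- With this `δ` both `m + δ` and `m - δ` stay in the unit disc, and `Φ` is the midpoint of the
  -- corresponding stochastic maps.
  set δ : ℝ := 1 - ‖m‖ with hδ
  have hpos : 0 < δ := sub_pos.mpr (lt_of_le_of_ne hm hne)
  have hn : ‖(δ : ℂ)‖ = δ := by rw [Complex.norm_real, Real.norm_of_nonneg hpos.le]
  have hplus : ‖m + δ‖ ≤ 1 := (norm_add_le _ _).trans (by rw [hn, hδ]; linarith)
  have hminus : ‖m - δ‖ ≤ 1 := (norm_sub_le _ _).trans (by rw [hn, hδ]; linarith)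
  have hst : ∀ {w : ℂ}, ‖w‖ ≤ 1 → dephasingMap P Q w ∈ stochasticMaps := fun hw =>
    dephasingMap_mem_stochasticMaps hPu hw (by rw [hP, hQ, dephase_one])
  have hseg : Φ ∈ openSegment ℝ (dephasingMap P Q (m + δ)) (dephasingMap P Q (m - δ)) := by
    refine ⟨1 / 2, 1 / 2, by norm_num, by norm_num, by norm_num, ?_⟩
    refine eq_of_forall_conjugate_eq hPu fun X => ?_
    have hdeph : dephase m X =
        (1 / 2 : ℝ) • dephase (m + δ) X + (1 / 2 : ℝ) • dephase (m - δ) X := by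
      ext i j
      fin_cases i <;> fin_cases j <;> simp [dephase] <;> ring
    rw [h, hdeph, Matrix.mul_add, Matrix.add_mul, Matrix.mul_smul, Matrix.mul_smul,
      Matrix.smul_mul, Matrix.smul_mul, ← dephasingMap_apply hPu hplus,
      ← dephasingMap_apply hPu hminus]
    rfl
  have heq := hΦ.2 (hst hplus) (hst hminus) hseg
  have h01 := h (single 0 1 1)
  rw [← heq, dephasingMap_apply hPu hplus] at h01
  have hc : ∀ Y, Qᴴ * (Q * Y * Qᴴ) * Q = Y := fun Y => by
    calc Qᴴ * (Q * Y * Qᴴ) * Q = (Qᴴ * Q) * Y * (Qᴴ * Q) := by simp only [Matrix.mul_assoc]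
      _ = Y := by rw [hQ, one_mul, mul_one]
  have h01' := congrArg (fun Y => (Qᴴ * Y * Q) 0 1) h01
  simp only [hc] at h01'
  have : (δ : ℂ) = 0 := by simpa [dephase] using h01'
  exact hpos.ne' (by exact_mod_cast this)

open scoped ComplexOrder in
theorem pureStates_subset_image_of_dephase {Φ : QubitMap} (hΦ : Φ ∈ stochasticMaps) {P Q : M₂}
    {m : ℂ} (hQ : Qᴴ * Q = 1) (hm : ‖m‖ = 1)
    (h : ∀ X, Φ (P * X * Pᴴ) = Q * dephase m X * Qᴴ) : pureStates ⊆ Φ '' densityMatrices := by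
  intro ρ hρ
  obtain ⟨φ, hφ, rfl⟩ := mem_pureStates_iff_exists_vecMulVec.mp hρ
  have hd := vecMulVec_mem_densityMatrices hφ
  generalize vecMulVec φ (star φ) = ρ at hd
  -- For `‖m‖ = 1`, `dephase m` is conjugation by a diagonal unitary, which `D` undoes; the preimage
  -- of `ρ` is then explicit.
  let D : M₂ := diagonal ![1, conj m]
  have hmm : m * conj m = 1 := by rw [Complex.mul_conj', hm]; norm_num
  have hD : ∀ Y, dephase m (Dᴴ * Y * D) = Y := by
    intro Y
    ext i j
    fin_cases i <;> fin_cases j <;> simp [D, dephase, diagonal_mul, mul_diagonal]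
    · linear_combination Y 0 1 * hmm
    · linear_combination Y 1 0 * hmm
    · linear_combination Y 1 1 * hmm
  have hQ' := mul_eq_one_comm.mp hQ
  have himg : Φ (P * (Dᴴ * (Qᴴ * ρ * Q) * D) * Pᴴ) = ρ := by
    rw [h, hD]
    calc Q * (Qᴴ * ρ * Q) * Qᴴ = (Q * Qᴴ) * ρ * (Q * Qᴴ) := by simp only [Matrix.mul_assoc]
      _ = ρ := by rw [hQ', one_mul, mul_one]
  refine ⟨_, ⟨?_, ?_⟩, himg⟩
  · exact ((hd.1.conjTranspose_mul_mul_same _).conjTranspose_mul_mul_same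
      _).mul_mul_conjTranspose_same _
  · rw [← hΦ.2, himg, hd.2]

theorem pureStates_subset_image_of_unital_extreme {Φ : QubitMap}
    (hΦ : Φ ∈ stochasticMaps.extremePoints ℝ) (h1 : Φ 1 = 1)
    (hne : (Φ '' densityMatrices ∩ pureStates).Nonempty) :
    pureStates ⊆ Φ '' densityMatrices := by
  obtain ⟨ρ, hρΦ, hρ⟩ := hne
  obtain ⟨P, Q, m, hP, hQ, hm, hX⟩ := exists_dephase_of_orthogonal hΦ.1 hρ
    (one_sub_mem_pureStates hρ) hρΦ (one_sub_mem_image h1 hρΦ) (ne_one_sub_of_mem_pureStates hρ)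
    (mul_one_sub_of_mem_pureStates hρ)
  exact pureStates_subset_image_of_dephase hΦ.1 hQ
    (norm_eq_one_of_dephase_mem_extremePoints hΦ hP hQ hm hX) hX

end ImagePureStates

/-! ### Choi's criterion, and a pure output for every extreme map. -/

section ExtremeMaps

variable {ι : Type*} [Fintype ι]

/-- The map `Z ↦ ∑ k l, X k l • (A k * Z * (A l)ᴴ)`, as a function of `X`. -/
noncomputable def sandwich (A : ι → M₂) (X : Matrix ι ι ℂ) : QubitMap :=
  ∑ k, ∑ l, X k l • LinearMap.toContinuousLinearMap (LinearMap.mulLeftRight ℂ (A k, (A l)ᴴ))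

/-- The dual of `sandwich A X`, evaluated at the identity. -/
noncomputable def sandwichGram (A : ι → M₂) (X : Matrix ι ι ℂ) : M₂ :=
  ∑ k, ∑ l, X k l • ((A l)ᴴ * A k)

theorem sandwich_apply (A : ι → M₂) (X : Matrix ι ι ℂ) (Z : M₂) :
    sandwich A X Z = ∑ k, ∑ l, X k l • (A k * Z * (A l)ᴴ) := by
  simp [sandwich]

theorem sandwich_add (A : ι → M₂) (X Y : Matrix ι ι ℂ) :
    sandwich A (X + Y) = sandwich A X + sandwich A Y := by
  ext1 Z
  change _ = sandwich A X Z + sandwich A Y Z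
  simp only [sandwich_apply, Matrix.add_apply, add_smul, Finset.sum_add_distrib]

theorem sandwich_smul (A : ι → M₂) (c : ℂ) (X : Matrix ι ι ℂ) :
    sandwich A (c • X) = c • sandwich A X := by
  ext1 Z
  change _ = c • sandwich A X Z
  simp only [sandwich_apply, Matrix.smul_apply, smul_eq_mul, Finset.smul_sum, mul_smul]

theorem sandwichGram_add (A : ι → M₂) (X Y : Matrix ι ι ℂ) :
    sandwichGram A (X + Y) = sandwichGram A X + sandwichGram A Y := by
  simp [sandwichGram, add_smul, Finset.sum_add_distrib]

theorem sandwichGram_smul (A : ι → M₂) (c : ℂ) (X : Matrix ι ι ℂ) :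
    sandwichGram A (c • X) = c • sandwichGram A X := by
  simp [sandwichGram, Finset.smul_sum, mul_smul]

theorem sandwichGram_conjTranspose (A : ι → M₂) (X : Matrix ι ι ℂ) :
    sandwichGram A Xᴴ = (sandwichGram A X)ᴴ := by
  simp only [sandwichGram, conjTranspose_sum, conjTranspose_smul, conjTranspose_mul,
    conjTranspose_conjTranspose, conjTranspose_apply]
  exact Finset.sum_comm

theorem sandwich_one [DecidableEq ι] (A : ι → M₂) : sandwich A 1 = krausMap A := by
  ext1 Z
  simp [sandwich_apply, krausMap_apply, Matrix.one_apply]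

theorem sandwichGram_one [DecidableEq ι] (A : ι → M₂) :
    sandwichGram A 1 = ∑ k, (A k)ᴴ * A k := by
  simp [sandwichGram, Matrix.one_apply]

theorem sandwich_conjTranspose_mul_self (A : ι → M₂) (B : Matrix ι ι ℂ) :
    sandwich A (Bᴴ * B) = krausMap fun r => ∑ k, conj (B r k) • A k := by
  ext1 Z
  rw [sandwich_apply, krausMap_apply]
  simp only [conjTranspose_sum, conjTranspose_smul, Finset.sum_mul, Finset.mul_sum, Matrix.smul_mul,
    Matrix.mul_smul, Matrix.mul_apply, Finset.sum_smul, conjTranspose_apply, smul_smul,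
    RCLike.star_def, Complex.conj_conj]
  rw [Finset.sum_comm_cycle]
  refine Finset.sum_congr rfl fun r _ => ?_
  rw [Finset.sum_comm]
  simp only [mul_comm]

theorem sandwichGram_conjTranspose_mul_self (A : ι → M₂) (B : Matrix ι ι ℂ) :
    sandwichGram A (Bᴴ * B) =
      ∑ r, (∑ k, conj (B r k) • A k)ᴴ * ∑ k, conj (B r k) • A k := by
  simp only [sandwichGram, conjTranspose_sum, conjTranspose_smul, Finset.sum_mul, Finset.mul_sum,
    Matrix.smul_mul, Matrix.mul_smul, Matrix.mul_apply, Finset.sum_smul, conjTranspose_apply,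
    smul_smul, RCLike.star_def, Complex.conj_conj]
  exact Finset.sum_comm_cycle

open scoped ComplexOrder MatrixOrder in
theorem sandwich_mem_stochasticMaps [DecidableEq ι] {A : ι → M₂} {X : Matrix ι ι ℂ}
    (hX : X.PosSemidef) (h : sandwichGram A X = 1) : sandwich A X ∈ stochasticMaps := by
  obtain ⟨B, rfl⟩ := CStarAlgebra.nonneg_iff_eq_star_mul_self.mp hX.nonneg
  rw [star_eq_conjTranspose] at h ⊢
  rw [sandwich_conjTranspose_mul_self]
  rw [sandwichGram_conjTranspose_mul_self] at h
  exact krausMap_mem_stochasticMaps h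

-- A self-adjoint matrix of norm at most one is bounded below by `-1`. Scaling by `(‖H‖ + 1)⁻¹`
-- achieves this and also covers `H = 0`.
open scoped ComplexOrder MatrixOrder Matrix.Norms.L2Operator in
theorem Matrix.IsHermitian.exists_posSemidef_one_add_smul [DecidableEq ι] {H : Matrix ι ι ℂ}
    (hH : H.IsHermitian) :
    ∃ t : ℝ, 0 < t ∧ (1 + (t : ℂ) • H).PosSemidef ∧ (1 + (-t : ℂ) • H).PosSemidef := by
  have hpos : 0 < ‖H‖ + 1 := by positivity
  have key : ∀ {K : Matrix ι ι ℂ}, IsSelfAdjoint K → ‖K‖ ≤ 1 → (1 + K).PosSemidef := by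
    intro K hK hn
    have h1 := hK.neg_algebraMap_norm_le_self
    have h2 : algebraMap ℝ (Matrix ι ι ℂ) ‖K‖ ≤ algebraMap ℝ (Matrix ι ι ℂ) 1 :=
      algebraMap_mono _ hn
    rw [map_one] at h2
    rw [← nonneg_iff_posSemidef]
    have h3 := (neg_le_neg h2).trans h1
    rwa [neg_le_iff_add_nonneg'] at h3
  have hn : ‖H‖ / (‖H‖ + 1) ≤ 1 := by rw [div_le_one hpos]; linarith
  refine ⟨(‖H‖ + 1)⁻¹, inv_pos.mpr hpos, key ?_ ?_, key ?_ ?_⟩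
  · exact IsSelfAdjoint.smul (by simp [isSelfAdjoint_iff]) hH
  · rw [norm_smul, Complex.norm_real, Real.norm_of_nonneg (inv_pos.mpr hpos).le, mul_comm]
    exact hn
  · exact IsSelfAdjoint.smul (by simp [isSelfAdjoint_iff]) hH
  · rw [norm_smul, norm_neg, Complex.norm_real, Real.norm_of_nonneg (inv_pos.mpr hpos).le, mul_comm]
    exact hn

/-- Perturbing the coefficient matrix `1` by `± t • H` keeps positivity and trace preservation, so
the Kraus map is a midpoint of two stochastic maps and extremality forbids any change. -/
theorem sandwich_eq_zero_of_isHermitian [DecidableEq ι] {A : ι → M₂}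
    (hA : krausMap A ∈ stochasticMaps.extremePoints ℝ) (hone : ∑ k, (A k)ᴴ * A k = 1)
    {H : Matrix ι ι ℂ} (hH : H.IsHermitian) (h : sandwichGram A H = 0) : sandwich A H = 0 := by
  obtain ⟨t, ht, hp, hm⟩ := hH.exists_posSemidef_one_add_smul
  have hg : ∀ c : ℂ, sandwichGram A (1 + c • H) = 1 := fun c => by
    rw [sandwichGram_add, sandwichGram_smul, h, smul_zero, add_zero, sandwichGram_one, hone]
  have hs : ∀ c : ℂ, sandwich A (1 + c • H) = krausMap A + c • sandwich A H := fun c => by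
    rw [sandwich_add, sandwich_smul, sandwich_one]
  have heq := hA.2 (sandwich_mem_stochasticMaps hp (hg _)) (sandwich_mem_stochasticMaps hm (hg _)) (by
    refine ⟨1 / 2, 1 / 2, by norm_num, by norm_num, by norm_num, ?_⟩
    rw [hs, hs]
    ext1 Z
    change (1 / 2 : ℝ) • (krausMap A Z + (t : ℂ) • sandwich A H Z) +
      (1 / 2 : ℝ) • (krausMap A Z + (-t : ℂ) • sandwich A H Z) = krausMap A Z
    module)
  rw [hs, add_eq_left] at heq
  ext1 Z
  have hZ : (t : ℂ) • sandwich A H Z = 0 := DFunLike.congr_fun heq Z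
  rw [smul_eq_zero] at hZ
  exact hZ.resolve_left (by exact_mod_cast ht.ne')

theorem sandwich_eq_zero_of_sandwichGram_eq_zero [DecidableEq ι] {A : ι → M₂}
    (hA : krausMap A ∈ stochasticMaps.extremePoints ℝ) (hone : ∑ k, (A k)ᴴ * A k = 1)
    {X : Matrix ι ι ℂ} (h : sandwichGram A X = 0) : sandwich A X = 0 := by
  have h' : sandwichGram A Xᴴ = 0 := by rw [sandwichGram_conjTranspose, h, conjTranspose_zero]
  have h₁ := sandwich_eq_zero_of_isHermitian hA hone (H := X + Xᴴ)
    (isHermitian_add_transpose_self X) (by rw [sandwichGram_add, h, h', add_zero])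
  have h₂ := sandwich_eq_zero_of_isHermitian hA hone (H := Complex.I • X + (-Complex.I) • Xᴴ)
    (by
      rw [IsHermitian, conjTranspose_add, conjTranspose_smul, conjTranspose_smul,
        conjTranspose_conjTranspose, add_comm]
      simp)
    (by rw [sandwichGram_add, sandwichGram_smul, sandwichGram_smul, h, h']; simp)
  -- Real and imaginary parts: `X` is a complex combination of two Hermitian matrices to which the
  -- preceding lemma applies.
  have hX : X = (1 / 2 : ℂ) • ((X + Xᴴ) + (-Complex.I) • (Complex.I • X + (-Complex.I) • Xᴴ)) := by
    rw [smul_add (-Complex.I), smul_smul, smul_smul]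
    simp only [neg_mul, Complex.I_mul_I, neg_neg, mul_neg, one_smul, neg_smul]
    ext i j
    simp
    ring
  rw [hX, sandwich_smul, sandwich_add, h₁, sandwich_smul, h₂]
  ext1 Z
  change (1 / 2 : ℂ) • ((0 : M₂) + (-Complex.I) • (0 : M₂)) = 0
  rw [smul_zero, add_zero, smul_zero]

/-- Three Kraus operators give nine products `(A l)ᴴ * A k` in a space of dimension four, hence a
nontrivial relation `g`. By extremality `g` also annihilates the maps `Z ↦ A k * Z * (A l)ᴴ`, and
independence of the operators, used once in each index, forces `g = 0`. -/
theorem not_linearIndependent_of_extreme [DecidableEq ι] {A : ι → M₂}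
    (hA : krausMap A ∈ stochasticMaps.extremePoints ℝ) (hone : ∑ k, (A k)ᴴ * A k = 1)
    (f : Fin 3 → ι) : ¬ LinearIndependent ℂ fun a => A (f a) := by
  intro hli
  have hdep : ¬ LinearIndependent ℂ fun p : Fin 3 × Fin 3 => (A (f p.2))ᴴ * A (f p.1) := by
    intro h
    have := h.fintype_card_le_finrank
    rw [Module.finrank_matrix] at this
    simp at this
  obtain ⟨g, hg, ⟨p, hp⟩⟩ := Fintype.not_linearIndependent_iff.mp hdep
  let X : Matrix ι ι ℂ := ∑ q : Fin 3 × Fin 3, single (f q.1) (f q.2) (g q)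
  have hX : ∀ {V : Type} [AddCommGroup V] [Module ℂ V] (G : ι → ι → V),
      ∑ k, ∑ l, X k l • G k l = ∑ q : Fin 3 × Fin 3, g q • G (f q.1) (f q.2) := by
    intro V _ _ G
    have : ∀ k l, X k l • G k l =
        ∑ q : Fin 3 × Fin 3, (if f q.1 = k ∧ f q.2 = l then g q else 0) • G k l := by
      intro k l
      rw [← Finset.sum_smul]
      simp [X, Matrix.sum_apply, single_apply]
    simp only [this]
    rw [Finset.sum_comm_cycle]
    refine Finset.sum_congr rfl fun q _ => ?_
    simp [ite_and]
  have h0 := sandwich_eq_zero_of_sandwichGram_eq_zero hA hone (X := X)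
    ((hX fun k l => (A l)ᴴ * A k).trans hg)
  have hZ : ∀ u i v j : Fin 2,
      ∑ a, ∑ b, g (a, b) * (A (f a) u i * conj (A (f b) v j)) = 0 := by
    intro u i v j
    have := congrFun (congrFun (DFunLike.congr_fun h0 (single i j (1 : ℂ))) u) v
    rw [sandwich_apply, hX fun k l => A k * single i j (1 : ℂ) * (A l)ᴴ, Matrix.sum_apply,
      Fintype.sum_prod_type] at this
    have hs : ∀ Y W : M₂, (Y * (single i j (1 : ℂ) : M₂) * Wᴴ) u v = Y u i * conj (W v j) := by
      intro Y W
      fin_cases i <;> fin_cases j <;> simp [Matrix.mul_apply, Fin.sum_univ_two]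
    simpa [hs] using this
  have hrow : ∀ (v j : Fin 2) (a : Fin 3), ∑ b, g (a, b) * conj (A (f b) v j) = 0 := by
    intro v j
    refine Fintype.linearIndependent_iff.mp hli _ ?_
    ext u i
    rw [Matrix.sum_apply, Matrix.zero_apply, ← hZ u i v j]
    refine Finset.sum_congr rfl fun a _ => ?_
    rw [Matrix.smul_apply, smul_eq_mul, Finset.sum_mul]
    exact Finset.sum_congr rfl fun b _ => by ring
  apply hp
  have := Fintype.linearIndependent_iff.mp hli (fun b => conj (g (p.1, b))) (by
    ext v j
    have := congrArg conj (hrow v j p.1)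
    simpa [Matrix.sum_apply] using this) p.2
  simpa using this

theorem exists_pair_of_extreme [DecidableEq ι] {A : ι → M₂}
    (hA : krausMap A ∈ stochasticMaps.extremePoints ℝ) (hone : ∑ k, (A k)ᴴ * A k = 1) :
    ∃ B C : M₂, ∀ k, ∃ b c : ℂ, b • B + c • C = A k := by
  obtain ⟨f, hf, hspan, hli⟩ := Submodule.exists_fun_fin_finrank_span_eq ℂ (Set.range A)
  generalize Module.finrank ℂ (Submodule.span ℂ (Set.range A)) = r at f hf hspan hli
  choose e he using hf
  have hr : r < 3 := by
    by_contra! h3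
    refine not_linearIndependent_of_extreme hA hone (fun a => e (Fin.castLE h3 a)) ?_
    simp only [he]
    exact hli.comp _ (Fin.castLE_injective h3)
  -- A span of dimension below two is padded with zero matrices.
  refine ⟨if h : 0 < r then f ⟨0, h⟩ else 0, if h : 1 < r then f ⟨1, h⟩ else 0, fun k => ?_⟩
  rw [← Submodule.mem_span_pair]
  have hk : A k ∈ Submodule.span ℂ (Set.range f) := by
    rw [hspan]
    exact Submodule.subset_span ⟨k, rfl⟩
  refine Submodule.span_le.mpr ?_ hk
  rintro _ ⟨⟨i, hi⟩, rfl⟩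
  apply Submodule.subset_span
  obtain rfl | rfl : i = 0 ∨ i = 1 := by omega
  · simp [hi]
  · simp [hi]

/-- The determinant of the pair `B *ᵥ ψ`, `C *ᵥ ψ` is a quadratic form in the two coordinates of
`ψ`, which has a nontrivial zero over ℂ: `![1, 0]` if the leading coefficient vanishes, otherwise
`![x, 1]` for a root `x`. -/
theorem exists_ne_zero_mulVec_parallel (B C : M₂) :
    ∃ ψ : Fin 2 → ℂ, ψ ≠ 0 ∧ (B *ᵥ ψ) 0 * (C *ᵥ ψ) 1 = (B *ᵥ ψ) 1 * (C *ᵥ ψ) 0 := by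
  by_cases ha : B 0 0 * C 1 0 - B 1 0 * C 0 0 = 0
  · refine ⟨![1, 0], fun h => by simpa using congrFun h 0, ?_⟩
    simp [mulVec, dotProduct, Fin.sum_univ_two]
    linear_combination ha
  · obtain ⟨x, hx⟩ := exists_quadratic_eq_zero ha
      (b := B 0 0 * C 1 1 + B 0 1 * C 1 0 - B 1 0 * C 0 1 - B 1 1 * C 0 0)
      (c := B 0 1 * C 1 1 - B 1 1 * C 0 1) (IsAlgClosed.exists_eq_mul_self _)
    refine ⟨![x, 1], fun h => by simpa using congrFun h 1, ?_⟩
    simp [mulVec, dotProduct, Fin.sum_univ_two]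
    linear_combination hx

theorem exists_common_direction {u v : Fin 2 → ℂ} (h : u 0 * v 1 = u 1 * v 0) :
    ∃ (φ : Fin 2 → ℂ) (c d : ℂ), u = c • φ ∧ v = d • φ := by
  by_cases h0 : u 0 = 0
  · by_cases h1 : u 1 = 0
    · refine ⟨v, 0, 1, ?_, by simp⟩
      ext i
      fin_cases i <;> simp [h0, h1]
    · refine ⟨u, 1, v 1 / u 1, by simp, ?_⟩
      ext i
      fin_cases i <;> simp <;> field_simp
      linear_combination -h
  · refine ⟨u, 1, v 0 / u 0, by simp, ?_⟩
    ext i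
    fin_cases i <;> simp <;> field_simp
    linear_combination h

theorem image_inter_pureStates_nonempty_of_extreme {Φ : QubitMap}
    (hΦ : Φ ∈ stochasticMaps.extremePoints ℝ) :
    (Φ '' densityMatrices ∩ pureStates).Nonempty := by
  obtain ⟨A, rfl, hone⟩ := exists_krausMap_of_mem_stochasticMaps hΦ.1
  obtain ⟨B, C, hBC⟩ := exists_pair_of_extreme hΦ hone
  choose b c hbc using hBC
  obtain ⟨ψ, hψ, hpar⟩ := exists_ne_zero_mulVec_parallel B C
  obtain ⟨φ, β, γ, hB, hC⟩ := exists_common_direction hpar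
  obtain ⟨t, -, ht⟩ := exists_smul_unit hψ
  have hd := vecMulVec_mem_densityMatrices ht
  refine ⟨_, ⟨_, hd, rfl⟩, ?_⟩
  have hd' := map_mem_densityMatrices hΦ.1 hd
  rw [mem_pureStates_iff_det]
  refine ⟨hd'.1.1, hd'.2, ?_⟩
  -- Every `A k` lies in the span of `B` and `C`, hence sends `ψ` into the line of `φ`; all Kraus
  -- terms are multiples of one rank one matrix and the determinant vanishes.
  have hk : ∀ k, A k * vecMulVec ((t : ℂ) • ψ) (star ((t : ℂ) • ψ)) * (A k)ᴴ =
      (t * (b k * β + c k * γ) * conj (t * (b k * β + c k * γ))) • vecMulVec φ (star φ) := by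
    intro k
    have : A k *ᵥ ((t : ℂ) • ψ) = (t * (b k * β + c k * γ)) • φ := by
      rw [← hbc, mulVec_smul, add_mulVec, smul_mulVec, smul_mulVec, hB, hC, smul_smul, smul_smul,
        ← add_smul, smul_smul]
    rw [mul_vecMulVec, vecMulVec_mul, ← star_mulVec, this, star_smul, smul_vecMulVec,
      vecMulVec_smul, smul_smul]
    rfl
  rw [krausMap_apply]
  simp only [hk]
  rw [← Finset.sum_smul, det_smul, det_fin_two]
  simp only [vecMulVec_apply]
  ring

end ExtremeMaps

theorem mainTheorem9 (Φ : QubitMap) (hΦ : Φ ∈ stochasticMaps) :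
    (Φ ∈ stochasticMaps.extremePoints ℝ → (Φ '' densityMatrices ∩ pureStates).Nonempty) ∧
    ((Φ '' densityMatrices ∩ pureStates).Nontrivial →
      Φ ∈ closure (stochasticMaps.extremePoints ℝ)) ∧
    (∀ ρ ∈ pureStates, ∀ σ ∈ pureStates, ρ ≠ σ → ρ * σ ≠ 0 →
      Φ '' densityMatrices ∩ blochSphere = {ρ, σ} →
        Φ ∈ stochasticMaps.extremePoints ℝ ∧ Φ 1 ≠ 1) ∧
    (blochSphere ⊆ Φ '' densityMatrices ↔
      Φ ∈ stochasticMaps.extremePoints ℝ ∧ Φ 1 = 1) := by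
  rw [blochSphere_eq_pureStates]
  refine ⟨image_inter_pureStates_nonempty_of_extreme,
    mem_closure_extremePoints_of_nontrivial hΦ, fun ρ hρ σ hσ hne h0 h => ⟨?_, ?_⟩,
    unital_extreme_of_pureStates_subset hΦ, fun h => ?_⟩
  · have hρ' : ρ ∈ Φ '' densityMatrices ∩ pureStates := by simp [h]
    have hσ' : σ ∈ Φ '' densityMatrices ∩ pureStates := by simp [h]
    exact mem_extremePoints_of_nonorthogonal hΦ hρ hσ hρ'.1 hσ'.1 hne h0
  · exact map_one_ne_one_of_inter_eq_pair hρ h0 h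
  · exact pureStates_subset_image_of_unital_extreme h.1 h.2
      (image_inter_pureStates_nonempty_of_extreme h.1)
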